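/- Let $I=(-1,1)$, let $L_k$ be the Legendre polynomial of degree $k$ with $L_k(1)=1$, let $\phi_k=\sqrt{k+1/2}\,L_k$ (an orthonormal basis of $L^2(I)$), and for a real- or complex-valued $v\in L^2(I)$ put $\hat v_k=\int_{-1}^1 v(x)\phi_k(x)\,dx$ and $d_2(v,\mathbb P_n)=\inf_{p\in\mathbb P_n}\|v-p\|_{L^2(I)}$, where $\mathbb P_n$ is the space of polynomials of degree at most $n$ (with real, respectively complex, coefficients). For $r>1$ let $\mathcal E_r\subset\mathbb C$ be the closed (filled) ellipse with foci $\pm1$ whose semiaxes have sum $r$, that is, $\mathcal E_r=\{z:|z-1|+|z+1|\le r+r^{-1}\}$. Proposition. For every $r>1$ there are constants $C(r)$ and $\tilde C(r)$, depending only on $r$, such that the following holds. Let $v\in L^2(I)$ be analytic in $\mathcal E_r$, that is, $v$ agrees a.e. on $I$ with a function (again denoted $v$) that is analytic at every point of $\mathcal E_r$. Then, with $\eta=\log r$, $$|\hat v_k|\le C(r)\,\Big(\max_{z\in\mathcal E_r}|v(z)|\Big)\sqrt{2(2k+1)}\;e^{-\eta k}\qquad\text{for all } k\ge 0,$$ $$d_2(v,\mathbb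 P_n)\le \tilde C(r)\,\Big(\max_{z\in\mathcal E_r}|v(z)|\Big)(n+1)^{1/2}\,e^{-\eta n}\qquad\text{for all } n\ge 0.$$ -/

import Mathlib

open MeasureTheory Polynomial

noncomputable section

namespace BernsteinLegendre

/-- The Legendre polynomial `L_k`, by Rodrigues' formula
`L_k = (1 / (2 ^ k k!)) D ^ k (x ^ 2 - 1) ^ k`; it satisfies `L_k(1) = 1`. -/
def legendre (k : ℕ) : ℝ[X] :=
  C ((2 ^ k * (k.factorial : ℝ))⁻¹) * derivative^[k] ((X ^ 2 - 1) ^ k)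

/-- The element `φ_k = √(k + 1/2) L_k` of the orthonormal Legendre basis of `L²(-1, 1)`. -/
def legendreBasis (k : ℕ) (x : ℝ) : ℝ :=
  Real.sqrt ((k : ℝ) + 1 / 2) * (legendre k).eval x

/-- Lebesgue measure on the interval `I = (-1, 1)`. -/
def intervalMeasure : Measure ℝ := volume.restrict (Set.Ioo (-1) 1)

/-- The normalized Legendre coefficient `v̂_k = ∫_{-1}^1 v φ_k dx`. -/
def legendreCoeff {𝕜 : Type*} [RCLike 𝕜] (v : ℝ → 𝕜) (k : ℕ) : 𝕜 :=
  ∫ x, legendreBasis k x • v x ∂intervalMeasure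

/-- The distance `d₂(v, P_n) = inf_{p ∈ P_n} ‖v - p‖_{L²(I)}` of `v` to the space `P_n` of
polynomials of degree at most `n`. -/
def polyDist {𝕜 : Type*} [RCLike 𝕜] (v : ℝ → 𝕜) (n : ℕ) : ℝ :=
  ⨅ p : degreeLE 𝕜 (n : WithBot ℕ),
    (eLpNorm (fun x : ℝ => v x - (p : 𝕜[X]).eval (x : 𝕜)) 2 intervalMeasure).toReal

/-- The closed (filled) ellipse with foci `±1` and semiaxes `(r + r⁻¹) / 2` and `(r - r⁻¹) / 2`,
whose sum is `r`: the set of points whose distances to the foci add up to at most twice the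
major semiaxis. -/
def ellipse (r : ℝ) : Set ℂ :=
  {z : ℂ | dist z 1 + dist z (-1) ≤ 2 * ((r + r⁻¹) / 2)}

end BernsteinLegendre

end

namespace BernsteinLegendre

open Set Metric

/-! Both estimates follow from uniform approximation on `[-1, 1]` by polynomials of degree below
`k`, with error `2r/(r-1) * M * r⁻¹ ^ k`, where `M` bounds `F` on the ellipse
(`exists_polynomial_approx`). Under `z = (w + w⁻¹)/2` the Chebyshev coefficients of `F` become
Fourier coefficients on the unit circle; moving the contour to `‖w‖ = r` makes them decay like `r⁻¹
^ n`, and the truncated series is the approximant. The `k`-th Legendre coefficient annihilates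
degrees below `k`, so it only sees this error, integrated against `φ_k` (`norm_legendreCoeff_le`).
The distance is bounded by the `L²` norm of the error (`polyDist_le`). -/

/-! ### Legendre polynomials: orthogonality and an `L²` bound -/

theorem intervalIntegral_derivative_mul (p q : ℝ[X]) (h₁ : p.eval 1 = 0) (h₂ : p.eval (-1) = 0) :
    ∫ x in (-1 : ℝ)..1, (derivative p).eval x * q.eval x =
      -∫ x in (-1 : ℝ)..1, p.eval x * (derivative q).eval x := by
  have h := intervalIntegral.integral_mul_deriv_eq_deriv_mul (a := -1) (b := 1)
    (fun x _ => p.hasDerivAt x) (fun x _ => q.hasDerivAt x)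
    ((derivative p).continuous.intervalIntegrable _ _)
    ((derivative q).continuous.intervalIntegrable _ _)
  rw [h, h₁, h₂]
  ring

theorem eval_iterate_derivative_sq_sub_one_pow {k m : ℕ} (h : m < k) {a : ℝ} (ha : a ^ 2 = 1) :
    (derivative^[m] ((X ^ 2 - 1 : ℝ[X]) ^ k)).eval a = 0 := by
  have hd := (dvd_pow_self (X ^ 2 - 1 : ℝ[X]) (Nat.sub_ne_zero_of_lt h)).trans
    (pow_sub_dvd_iterate_derivative_pow (X ^ 2 - 1 : ℝ[X]) k m)
  exact eval_eq_zero_of_dvd_of_eval_eq_zero hd (by simp [ha])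

theorem intervalIntegral_iterate_derivative_mul {k m : ℕ} (h : m ≤ k) (q : ℝ[X]) :
    ∫ x in (-1 : ℝ)..1, (derivative^[m] ((X ^ 2 - 1 : ℝ[X]) ^ k)).eval x * q.eval x =
      (-1) ^ m * ∫ x in (-1 : ℝ)..1, ((X ^ 2 - 1 : ℝ[X]) ^ k).eval x *
        (derivative^[m] q).eval x := by
  induction m generalizing q with
  | zero => simp
  | succ m ih =>
    rw [Function.iterate_succ_apply' derivative m, intervalIntegral_derivative_mul _ _
      (eval_iterate_derivative_sq_sub_one_pow h (by norm_num))
      (eval_iterate_derivative_sq_sub_one_pow h (by norm_num)), ih (Nat.le_of_succ_le h),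
      Function.iterate_succ_apply]
    ring

theorem intervalIntegral_legendre_mul (k : ℕ) (q : ℝ[X]) :
    ∫ x in (-1 : ℝ)..1, (legendre k).eval x * q.eval x =
      (2 ^ k * (k.factorial : ℝ))⁻¹ * ((-1) ^ k *
        ∫ x in (-1 : ℝ)..1, ((X ^ 2 - 1 : ℝ[X]) ^ k).eval x * (derivative^[k] q).eval x) := by
  rw [← intervalIntegral_iterate_derivative_mul le_rfl, ← intervalIntegral.integral_const_mul]
  simp only [legendre, eval_mul, eval_C, mul_assoc]

theorem intervalIntegral_legendre_mul_eq_zero {k : ℕ} {q : ℝ[X]} (hq : q.degree < k) :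
    ∫ x in (-1 : ℝ)..1, (legendre k).eval x * q.eval x = 0 := by
  rw [intervalIntegral_legendre_mul, iterate_derivative_eq_zero_of_degree_lt hq]
  simp

theorem iterate_derivative_legendre (k : ℕ) :
    derivative^[k] (legendre k) =
      C ((2 ^ k * (k.factorial : ℝ))⁻¹ * ((2 * k).factorial : ℝ)) := by
  have hm : ((X ^ 2 - 1 : ℝ[X]) ^ k).Monic := (monic_X_pow_sub_C (1 : ℝ) two_ne_zero).pow k
  have hd : ((X ^ 2 - 1 : ℝ[X]) ^ k).natDegree = 2 * k := by
    rw [natDegree_pow, show (X ^ 2 - 1 : ℝ[X]) = X ^ 2 - C 1 by simp, natDegree_X_pow_sub_C,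
      mul_comm]
  have h : derivative^[2 * k] ((X ^ 2 - 1 : ℝ[X]) ^ k) = C ((2 * k).factorial : ℝ) := by
    rw [eq_C_of_natDegree_le_zero ((natDegree_iterate_derivative _ _).trans (by rw [hd]; simp)),
      coeff_iterate_derivative, zero_add]
    have := hm.coeff_natDegree
    rw [hd] at this
    rw [this, Nat.descFactorial_self, nsmul_eq_mul, mul_one]
  rw [legendre, iterate_derivative_C_mul, ← Function.iterate_add_apply, ← two_mul, h, ← C_mul]

/-- Integrating by parts `k` times leaves `centralBinom k / 4 ^ k ≤ 1` times the integral of `(1 -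
x²)^k`. The crude bound, uniform in `k`, is enough. -/
theorem intervalIntegral_legendre_sq_le (k : ℕ) :
    ∫ x in (-1 : ℝ)..1, (legendre k).eval x ^ 2 ≤ 2 := by
  have hW : |∫ x in (-1 : ℝ)..1, ((X ^ 2 - 1 : ℝ[X]) ^ k).eval x| ≤ 2 := by
    have := intervalIntegral.norm_integral_le_of_norm_le_const (a := (-1 : ℝ)) (b := 1) (C := 1)
      (f := fun x => ((X ^ 2 - 1 : ℝ[X]) ^ k).eval x) (by
        intro x hx
        rw [uIoc_of_le (by norm_num)] at hx
        simp only [eval_pow, eval_sub, eval_X, eval_one, norm_pow, Real.norm_eq_abs]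
        exact pow_le_one₀ (abs_nonneg _) (abs_le.2 ⟨by nlinarith [hx.1], by nlinarith [hx.1, hx.2]⟩))
    rw [Real.norm_eq_abs] at this
    norm_num at this
    simpa using this
  simp only [sq (eval _ _)]
  rw [intervalIntegral_legendre_mul, iterate_derivative_legendre]
  simp only [eval_C, intervalIntegral.integral_mul_const]
  set c : ℝ := (2 ^ k * (k.factorial : ℝ))⁻¹ with hc
  have hcc : c * (c * ((2 * k).factorial : ℝ)) ≤ 1 := by
    have h₁ : ((2 * k).factorial : ℝ) = k.centralBinom * k.factorial * k.factorial := by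
      have := Nat.choose_mul_factorial_mul_factorial (show k ≤ 2 * k by lia)
      rw [← Nat.centralBinom_eq_two_mul_choose, show 2 * k - k = k by lia] at this
      exact_mod_cast this.symm
    have h₂ : (k.centralBinom : ℝ) ≤ 4 ^ k := by exact_mod_cast Nat.centralBinom_le_four_pow k
    have h₃ : (0 : ℝ) < k.factorial := by positivity
    have h₄ : (4 : ℝ) ^ k = 2 ^ k * 2 ^ k := by rw [← mul_pow]; norm_num
    rw [h₁, hc]
    calc _ = (k.centralBinom : ℝ) / 4 ^ k := by rw [h₄]; field_simp
      _ ≤ 1 := (div_le_one (by positivity)).2 h₂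
  have hcc0 : 0 ≤ c * (c * ((2 * k).factorial : ℝ)) := by positivity
  calc _ = c * (c * ((2 * k).factorial : ℝ)) *
        ((-1) ^ k * ∫ x in (-1 : ℝ)..1, ((X ^ 2 - 1 : ℝ[X]) ^ k).eval x) := by ring
    _ ≤ c * (c * ((2 * k).factorial : ℝ)) * 2 := by
        refine mul_le_mul_of_nonneg_left ((le_abs_self _).trans ?_) hcc0
        rwa [abs_mul, abs_pow, abs_neg, abs_one, one_pow, one_mul]
    _ ≤ 2 := by linarith

/-! ### Legendre coefficients -/

theorem integral_intervalMeasure {E : Type*} [NormedAddCommGroup E] [NormedSpace ℝ E]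
    (f : ℝ → E) : ∫ x, f x ∂intervalMeasure = ∫ x in (-1 : ℝ)..1, f x := by
  rw [intervalIntegral.integral_of_le (by norm_num), integral_Ioc_eq_integral_Ioo,
    intervalMeasure]

instance : IsFiniteMeasure intervalMeasure := by
  unfold intervalMeasure; infer_instance

theorem intervalMeasure_univ : intervalMeasure univ = 2 := by
  simp [intervalMeasure]; norm_num

theorem integrable_intervalMeasure {E : Type*} [NormedAddCommGroup E] {f : ℝ → E}
    (hf : Continuous f) : Integrable f intervalMeasure :=
  (hf.integrableOn_Icc (a := -1) (b := 1)).mono_set Ioo_subset_Icc_self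

theorem integral_abs_legendre_le (k : ℕ) :
    ∫ x, |(legendre k).eval x| ∂intervalMeasure ≤ 2 := by
  have hc : Continuous fun x : ℝ => (legendre k).eval x := (legendre k).continuous
  calc ∫ x, |(legendre k).eval x| ∂intervalMeasure
      ≤ ∫ x, (1 + (legendre k).eval x ^ 2) / 2 ∂intervalMeasure := by
        refine integral_mono (integrable_intervalMeasure (by fun_prop))
          (integrable_intervalMeasure (by fun_prop)) fun x => ?_
        have := sq_nonneg (|(legendre k).eval x| - 1)
        have := sq_abs ((legendre k).eval x)
        dsimp only
        linarith
    _ = (2 + ∫ x in (-1 : ℝ)..1, (legendre k).eval x ^ 2) / 2 := by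
        rw [integral_intervalMeasure, intervalIntegral.integral_div,
          intervalIntegral.integral_add (by simp)
            (Continuous.intervalIntegrable (by fun_prop) _ _)]
        norm_num
    _ ≤ 2 := by linarith [intervalIntegral_legendre_sq_le k]

theorem legendreCoeff_polynomial_eq_zero {𝕜 : Type*} [RCLike 𝕜] {k : ℕ} {q : 𝕜[X]}
    (hq : q.degree < k) : legendreCoeff (fun x : ℝ => q.eval (x : 𝕜)) k = 0 := by
  have h (j : ℕ) (hj : j ∈ q.support) :
      ∫ x, legendreBasis k x • (q.coeff j * (x : 𝕜) ^ j) ∂intervalMeasure = 0 := by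
    have hjk : (X ^ j : ℝ[X]).degree < k := by
      rw [degree_X_pow]
      exact (le_degree_of_mem_supp j hj).trans_lt hq
    have h0 := intervalIntegral_legendre_mul_eq_zero hjk
    rw [← integral_intervalMeasure] at h0
    calc _ = ∫ x, ((√((k : ℝ) + 1 / 2) : 𝕜) * q.coeff j) *
          (((legendre k).eval x * (X ^ j : ℝ[X]).eval x : ℝ) : 𝕜) ∂intervalMeasure := by
          congr 1 with x
          simp only [legendreBasis, RCLike.real_smul_eq_coe_mul, eval_pow, eval_X]
          push_cast
          ring
      _ = 0 := by rw [integral_const_mul, integral_ofReal, h0]; simp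
  have hc : Continuous (legendreBasis k) := continuous_const.mul (legendre k).continuous
  simp only [legendreCoeff, eval_eq_sum, Polynomial.sum, Finset.smul_sum]
  rw [integral_finsetSum _ fun j _ => integrable_intervalMeasure (by fun_prop)]
  exact Finset.sum_eq_zero h

/-- Subtracting `q` leaves the coefficient unchanged, and `√(2(2k+1)) = 2√(k+1/2)` bounds the `L¹`
norm of `φ_k`. -/
theorem norm_legendreCoeff_le {𝕜 : Type*} [RCLike 𝕜] {k : ℕ} {v : ℝ → 𝕜} {q : 𝕜[X]} {ε : ℝ}
    (hv : Integrable v intervalMeasure) (hq : q.degree < k)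
    (h : ∀ᵐ x ∂intervalMeasure, ‖v x - q.eval (x : 𝕜)‖ ≤ ε) (hε : 0 ≤ ε) :
    ‖legendreCoeff v k‖ ≤ ε * √(2 * (2 * (k : ℝ) + 1)) := by
  have hc : Continuous (legendreBasis k) := continuous_const.mul (legendre k).continuous
  have hqc : Continuous fun x : ℝ => q.eval (x : 𝕜) := by fun_prop
  have hiv : Integrable (fun x => legendreBasis k x • v x) intervalMeasure := by
    obtain ⟨c, hc'⟩ := (isCompact_Icc (a := (-1 : ℝ)) (b := 1)).exists_bound_of_continuousOn
      hc.continuousOn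
    refine hv.bdd_smul c hc.aestronglyMeasurable ?_
    filter_upwards [ae_restrict_mem measurableSet_Ioo] with x hx
    exact hc' x (Ioo_subset_Icc_self hx)
  have hiq : Integrable (fun x : ℝ => legendreBasis k x • q.eval (x : 𝕜)) intervalMeasure :=
    integrable_intervalMeasure (hc.smul hqc)
  have h0 := legendreCoeff_polynomial_eq_zero hq
  have heq : legendreCoeff v k =
      ∫ x, legendreBasis k x • (v x - q.eval (x : 𝕜)) ∂intervalMeasure := by
    simp only [smul_sub]
    rw [integral_sub hiv hiq]
    exact (sub_eq_self.2 h0).symm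
  have hs : √(2 * (2 * (k : ℝ) + 1)) = 2 * √((k : ℝ) + 1 / 2) := by
    rw [show 2 * (2 * (k : ℝ) + 1) = 2 ^ 2 * (k + 1 / 2) by ring,
      Real.sqrt_mul (by norm_num), Real.sqrt_sq (by norm_num)]
  rw [heq, hs]
  calc _ ≤ ∫ x, ε * √((k : ℝ) + 1 / 2) * |(legendre k).eval x| ∂intervalMeasure := by
        refine norm_integral_le_of_norm_le
          (integrable_intervalMeasure (by fun_prop)) ?_
        filter_upwards [h] with x hx
        rw [norm_smul, legendreBasis, norm_mul, Real.norm_eq_abs, Real.norm_eq_abs,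
          abs_of_nonneg (Real.sqrt_nonneg _)]
        calc _ ≤ √((k : ℝ) + 1 / 2) * |(legendre k).eval x| * ε := by gcongr
          _ = _ := by ring
    _ = ε * √((k : ℝ) + 1 / 2) * ∫ x, |(legendre k).eval x| ∂intervalMeasure :=
        integral_const_mul _ _
    _ ≤ ε * √((k : ℝ) + 1 / 2) * 2 := by
        gcongr
        exact integral_abs_legendre_le k
    _ = _ := by ring

/-! ### The Joukowski map and the ellipse -/

/-- Since `z ∓ 1 = (w ∓ 1)²/(2w)`, the parallelogram law gives the sum of the focal distances as
`‖w‖ + ‖w‖⁻¹`. -/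
theorem joukowski_mem_ellipse {r : ℝ} (hr : 1 < r) {w : ℂ} (h₁ : r⁻¹ ≤ ‖w‖) (h₂ : ‖w‖ ≤ r) :
    (w + w⁻¹) / 2 ∈ ellipse r := by
  have hr0 : 0 < r := by linarith
  have hw : 0 < ‖w‖ := (inv_pos.2 hr0).trans_le h₁
  have hw0 : w ≠ 0 := norm_pos_iff.1 hw
  have e₁ : dist ((w + w⁻¹) / 2) 1 = ‖w - 1‖ ^ 2 / (2 * ‖w‖) := by
    rw [dist_eq_norm, ← norm_pow, show (w + w⁻¹) / 2 - 1 = (w - 1) ^ 2 / (2 * w) by field_simp; ring,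
      norm_div, norm_mul, Complex.norm_ofNat]
  have e₂ : dist ((w + w⁻¹) / 2) (-1) = ‖w + 1‖ ^ 2 / (2 * ‖w‖) := by
    rw [dist_eq_norm, ← norm_pow,
      show (w + w⁻¹) / 2 - -1 = (w + 1) ^ 2 / (2 * w) by field_simp; ring,
      norm_div, norm_mul, Complex.norm_ofNat]
  have hp := parallelogram_law_with_norm ℝ w 1
  have e₃ : dist ((w + w⁻¹) / 2) 1 + dist ((w + w⁻¹) / 2) (-1) = ‖w‖ + ‖w‖⁻¹ := by
    rw [e₁, e₂]
    rw [norm_one] at hp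
    field_simp
    linarith
  have h₃ : 1 ≤ r * ‖w‖ := by
    rw [inv_le_iff_one_le_mul₀ hr0] at h₁
    linarith
  rw [ellipse, mem_ofPred_eq, e₃]
  have : r + r⁻¹ - (‖w‖ + ‖w‖⁻¹) = (r - ‖w‖) * (r * ‖w‖ - 1) / (r * ‖w‖) := by
    field_simp
    ring
  have : 0 ≤ (r - ‖w‖) * (r * ‖w‖ - 1) / (r * ‖w‖) :=
    div_nonneg (mul_nonneg (by linarith) (by linarith)) (by positivity)
  linarith

theorem isCompact_ellipse (r : ℝ) : IsCompact (ellipse r) := by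
  refine Metric.isCompact_of_isClosed_isBounded
    (isClosed_le (by fun_prop) continuous_const) ?_
  refine Metric.isBounded_closedBall (x := (1 : ℂ)) (r := 2 * ((r + r⁻¹) / 2)) |>.subset ?_
  intro z hz
  exact (le_add_of_nonneg_right dist_nonneg).trans hz

theorem ofReal_mem_ellipse {r : ℝ} (hr : 1 < r) {x : ℝ} (h₁ : -1 ≤ x) (h₂ : x ≤ 1) :
    (x : ℂ) ∈ ellipse r := by
  have hr0 : 0 < r := by linarith
  have hr2 : 2 ≤ r + r⁻¹ := by
    have : r + r⁻¹ - 2 = (r - 1) ^ 2 / r := by field_simp; ring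
    have : 0 ≤ (r - 1) ^ 2 / r := by positivity
    linarith
  change dist (x : ℂ) 1 + dist (x : ℂ) (-1) ≤ _
  rw [← Complex.ofReal_one, ← Complex.ofReal_neg, Complex.dist_of_im_eq (by simp),
    Complex.dist_of_im_eq (by simp), Complex.ofReal_re, Complex.ofReal_re, Complex.ofReal_re,
    Real.dist_eq, Real.dist_eq, abs_of_nonpos (by linarith), abs_of_nonneg (by linarith)]
  linarith

/-! ### Fourier coefficients of the pull-back -/

/-- The pull-back `t ↦ F (cos t)` as a function on the circle of length `2π`. -/
noncomputable def circlePullback (F : ℂ → ℂ) (t : AddCircle (2 * Real.pi)) : ℂ :=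
  F ((fourier 1 t + fourier (-1) t) / 2)

instance : Fact (0 < 2 * Real.pi) := ⟨Real.two_pi_pos⟩

theorem fourier_coe (n : ℤ) (x : ℝ) :
    fourier n (x : AddCircle (2 * Real.pi)) = Complex.exp (x * Complex.I) ^ n := by
  rw [fourier_coe_apply, ← Complex.exp_int_mul]
  congr 1
  have : (Real.pi : ℂ) ≠ 0 := by exact_mod_cast Real.pi_ne_zero
  push_cast
  field_simp

theorem fourierCoeff_circlePullback_neg (F : ℂ → ℂ) (n : ℤ) :
    fourierCoeff (circlePullback F) (-n) = fourierCoeff (circlePullback F) n := by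
  rw [fourierCoeff, fourierCoeff, ← integral_neg_eq_self]
  congr 1 with t
  simp [circlePullback, add_comm]

theorem fourierCoeff_circlePullback_eq (F : ℂ → ℂ) (n : ℤ) :
    fourierCoeff (circlePullback F) n = (1 / (2 * Real.pi * Complex.I)) *
      ∮ w in C(0, 1), w ^ (-n - 1) * F ((w + w⁻¹) / 2) := by
  have hI : ∮ w in C(0, 1), w ^ (-n - 1) * F ((w + w⁻¹) / 2) =
      Complex.I * ∫ x in (0 : ℝ)..2 * Real.pi,
        fourier (-n) (x : AddCircle (2 * Real.pi)) • circlePullback F x := by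
    rw [circleIntegral, ← intervalIntegral.integral_const_mul]
    congr 1 with x
    have hx := Complex.exp_ne_zero (x * Complex.I)
    rw [circlePullback, fourier_coe, fourier_coe, fourier_coe, deriv_circleMap, circleMap_zero,
      Complex.ofReal_one, one_mul, zpow_sub_one₀ hx, zpow_one, zpow_neg_one, smul_eq_mul,
      smul_eq_mul]
    field_simp
  rw [hI, fourierCoeff_eq_intervalIntegral _ n 0, zero_add, Complex.real_smul, ← mul_assoc]
  congr 1
  have := Complex.I_ne_zero
  push_cast
  field_simp

/-- The integrand is holomorphic on the closed annulus `1 ≤ ‖w‖ ≤ r`, so the contour moves from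
radius `1` to `r`, where the trivial bound suffices. -/
theorem norm_fourierCoeff_circlePullback_le {r M : ℝ} (hr : 1 < r) {F : ℂ → ℂ}
    (hF : AnalyticOnNhd ℂ F (ellipse r)) (hM : ∀ z ∈ ellipse r, ‖F z‖ ≤ M) (n : ℤ) :
    ‖fourierCoeff (circlePullback F) n‖ ≤ M * r ^ (-n) := by
  have hr0 : 0 < r := by linarith
  have hd (w : ℂ) (h₁ : r⁻¹ ≤ ‖w‖) (h₂ : ‖w‖ ≤ r) :
      DifferentiableAt ℂ (fun w => w ^ (-n - 1) * F ((w + w⁻¹) / 2)) w := by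
    have hw0 : w ≠ 0 := norm_pos_iff.1 ((inv_pos.2 hr0).trans_le h₁)
    have hFd := (hF _ (joukowski_mem_ellipse hr h₁ h₂)).differentiableAt
    refine (differentiableAt_zpow.2 (Or.inl hw0)).mul ?_
    exact DifferentiableAt.comp w (f := fun w : ℂ => (w + w⁻¹) / 2) hFd
      ((differentiableAt_id.add (differentiableAt_inv hw0)).div_const 2)
  have hinv : r⁻¹ ≤ 1 := inv_le_one_of_one_le₀ hr.le
  have hI := Complex.circleIntegral_eq_of_differentiable_on_annulus_off_countable (c := 0)
    one_pos hr.le countable_empty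
    (f := fun w => w ^ (-n - 1) * F ((w + w⁻¹) / 2))
    (by
      rintro w ⟨h₁, h₂⟩
      rw [mem_closedBall_zero_iff] at h₁
      rw [mem_ball_zero_iff, not_lt] at h₂
      exact (hd w (hinv.trans h₂) h₁).continuousAt.continuousWithinAt)
    (by
      rintro w ⟨⟨h₁, h₂⟩, -⟩
      rw [mem_ball_zero_iff] at h₁
      rw [mem_closedBall_zero_iff, not_le] at h₂
      exact hd w (hinv.trans h₂.le) h₁.le)
  have hb := circleIntegral.norm_integral_le_of_norm_le_const (c := 0) hr0.le
    (f := fun w => w ^ (-n - 1) * F ((w + w⁻¹) / 2)) (C := r ^ (-n - 1) * M) (by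
      intro w hw
      rw [mem_sphere_zero_iff_norm] at hw
      rw [norm_mul, norm_zpow, hw]
      gcongr
      exact hM _ (joukowski_mem_ellipse hr (by rw [hw]; linarith) hw.le))
  rw [fourierCoeff_circlePullback_eq, ← hI, norm_mul]
  have hn : ‖1 / (2 * (Real.pi : ℂ) * Complex.I)‖ = 1 / (2 * Real.pi) := by
    simp [abs_of_pos Real.pi_pos]
  rw [hn]
  calc _ ≤ 1 / (2 * Real.pi) * (2 * Real.pi * r * (r ^ (-n - 1) * M)) := by gcongr
    _ = M * r ^ (-n) := by
      have := Real.pi_ne_zero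
      rw [zpow_sub_one₀ hr0.ne']
      field_simp

theorem continuous_circlePullback {r : ℝ} (hr : 1 < r) {F : ℂ → ℂ}
    (hF : AnalyticOnNhd ℂ F (ellipse r)) : Continuous (circlePullback F) := by
  refine hF.continuousOn.comp_continuous (by fun_prop) fun t => ?_
  have hn : ‖fourier 1 t‖ = 1 := by rw [fourier_apply, Circle.norm_coe]
  have : fourier (-1) t = (fourier 1 t)⁻¹ := by
    rw [fourier_neg, Complex.inv_eq_conj hn]
  rw [this]
  exact joukowski_mem_ellipse hr (by rw [hn]; exact inv_le_one_of_one_le₀ hr.le)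
    (by rw [hn]; exact hr.le)

/-! ### Chebyshev expansion -/

/-- The Chebyshev coefficients of `F`. -/
noncomputable def chebyshevCoeff (F : ℂ → ℂ) (n : ℕ) : ℂ :=
  2 * fourierCoeff (circlePullback F) n - if n = 0 then fourierCoeff (circlePullback F) 0 else 0

theorem norm_chebyshevCoeff_le {r M : ℝ} (hr : 1 < r) {F : ℂ → ℂ}
    (hF : AnalyticOnNhd ℂ F (ellipse r)) (hM : ∀ z ∈ ellipse r, ‖F z‖ ≤ M) (n : ℕ) :
    ‖chebyshevCoeff F n‖ ≤ 2 * M * r⁻¹ ^ n := by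
  have h := norm_fourierCoeff_circlePullback_le hr hF hM n
  rw [zpow_neg, zpow_natCast, ← inv_pow] at h
  have h2 : ‖chebyshevCoeff F n‖ ≤ 2 * ‖fourierCoeff (circlePullback F) n‖ := by
    rw [chebyshevCoeff]
    rcases eq_or_ne n 0 with rfl | hn
    · simp only [Nat.cast_zero, if_true, two_mul, add_sub_cancel_right]
      linarith [norm_nonneg (fourierCoeff (circlePullback F) 0)]
    · simp [hn]
  linarith

theorem hasSum_chebyshev {r : ℝ} (hr : 1 < r) {F : ℂ → ℂ}
    (hF : AnalyticOnNhd ℂ F (ellipse r)) {x : ℝ} (h₁ : -1 ≤ x) (h₂ : x ≤ 1) :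
    HasSum (fun n : ℕ => chebyshevCoeff F n * (Chebyshev.T ℂ n).eval (x : ℂ)) (F x) := by
  obtain ⟨M, hM⟩ := (isCompact_ellipse r).exists_bound_of_continuousOn hF.continuousOn
  have hr' : r⁻¹ < 1 := inv_lt_one_of_one_lt₀ hr
  have hg : Summable fun n : ℕ => fourierCoeff (circlePullback F) (n : ℤ) := by
    refine Summable.of_norm_bounded (g := fun n : ℕ => M * r⁻¹ ^ n)
      ((summable_geometric_of_lt_one (by positivity) hr').mul_left M) fun n => ?_
    have h := norm_fourierCoeff_circlePullback_le hr hF hM n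
    rwa [zpow_neg, zpow_natCast, ← inv_pow] at h
  have hs : Summable (fourierCoeff (circlePullback F)) :=
    Summable.of_nat_of_neg hg (by simpa only [fourierCoeff_circlePullback_neg] using hg)
  have hsum := (has_pointwise_sum_fourier_series_of_summable
    (f := ⟨circlePullback F, continuous_circlePullback hr hF⟩) hs (Real.arccos x : ℝ)).nat_add_neg
  -- Pairing `n` with `-n` counts frequency `0` twice; one copy is removed.
  have h0 := hsum.sub (hasSum_ite_eq 0 (fourierCoeff (circlePullback F) 0))
  have hcos (n : ℕ) : fourier (n : ℤ) ((Real.arccos x : ℝ) : AddCircle (2 * Real.pi)) +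
      fourier (-(n : ℤ)) ((Real.arccos x : ℝ) : AddCircle (2 * Real.pi)) =
        2 * (Chebyshev.T ℂ n).eval (x : ℂ) := by
    have hx : (x : ℂ) = Complex.cos (Real.arccos x : ℝ) := by
      rw [← Complex.ofReal_cos, Real.cos_arccos h₁ h₂]
    conv_rhs => rw [hx, Polynomial.Chebyshev.T_complex_cos, Complex.two_cos]
    rw [fourier_coe, fourier_coe, ← Complex.exp_int_mul, ← Complex.exp_int_mul]
    push_cast
    congr 2 <;> ring
  have hpt : circlePullback F (Real.arccos x : ℝ) = F x := by
    have h := hcos 1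
    rw [Nat.cast_one] at h
    rw [circlePullback, h]
    simp
  convert! h0 using 1
  · ext n
    simp only [ContinuousMap.coe_mk, fourierCoeff_circlePullback_neg, smul_eq_mul, ← mul_add, hcos,
      chebyshevCoeff]
    split_ifs with hn
    · subst hn; simp; ring
    · ring
  · simp [hpt]

/-- Truncated Chebyshev expansions converge geometrically for functions analytic in an ellipse. -/
theorem exists_polynomial_approx {r M : ℝ} (hr : 1 < r) {F : ℂ → ℂ}
    (hF : AnalyticOnNhd ℂ F (ellipse r)) (hM : ∀ z ∈ ellipse r, ‖F z‖ ≤ M) (k : ℕ) :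
    ∃ p : ℂ[X], p.degree < k ∧ ∀ x : ℝ, -1 ≤ x → x ≤ 1 →
      ‖F x - p.eval (x : ℂ)‖ ≤ 2 * r / (r - 1) * M * r⁻¹ ^ k := by
  have hr' : r⁻¹ < 1 := inv_lt_one_of_one_lt₀ hr
  have hr0 : 0 < r := by linarith
  refine ⟨∑ n ∈ Finset.range k, C (chebyshevCoeff F n) * Chebyshev.T ℂ n, ?_, ?_⟩
  · rw [← mem_degreeLT]
    refine Submodule.sum_mem _ fun n hn => ?_
    rw [← smul_eq_C_mul]
    refine Submodule.smul_mem _ _ ?_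
    rw [mem_degreeLT, Chebyshev.degree_T]
    simpa using hn
  · intro x h₁ h₂
    have hs := hasSum_chebyshev hr hF h₁ h₂
    have ht := (hasSum_nat_add_iff' k).2 hs
    have hT (n : ℕ) : ‖(Chebyshev.T ℂ n).eval (x : ℂ)‖ ≤ 1 := by
      rw [← Chebyshev.complex_ofReal_eval_T, Complex.norm_real, Real.norm_eq_abs,
        ← Real.cos_arccos h₁ h₂, Chebyshev.T_real_cos]
      exact Real.abs_cos_le_one _
    have hM0 : 0 ≤ M := (norm_nonneg _).trans (hM _ (ofReal_mem_ellipse hr h₁ h₂))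
    have hgeo := (hasSum_geometric_of_lt_one (by positivity) hr').mul_left (2 * M * r⁻¹ ^ k)
    have hb := tsum_of_norm_bounded hgeo
      (f := fun n : ℕ => chebyshevCoeff F (n + k) * (Chebyshev.T ℂ (n + k : ℕ)).eval (x : ℂ))
      fun n => by
        rw [norm_mul]
        calc _ ≤ 2 * M * r⁻¹ ^ (n + k) * 1 := by
              gcongr
              · exact norm_chebyshevCoeff_le hr hF hM _
              · exact hT _
          _ = _ := by rw [pow_add]; ring
    rw [ht.tsum_eq] at hb
    simp only [eval_finsetSum, eval_mul, eval_C]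
    refine hb.trans_eq ?_
    have : r - 1 ≠ 0 := by linarith
    field_simp

/-! ### Descent from `ℂ` to the scalar field -/

section Transfer

variable {𝕜 : Type*} [RCLike 𝕜]

theorem map_map_complex (a : 𝕜) : RCLike.map ℂ 𝕜 (RCLike.map 𝕜 ℂ a) = a := by
  simp only [RCLike.map_apply, RCLike.re_to_complex, RCLike.im_to_complex, RCLike.I_to_complex]
  simp

theorem norm_map_complex_le (z : ℂ) : ‖RCLike.map ℂ 𝕜 z‖ ≤ ‖z‖ := by
  rcases RCLike.I_eq_zero_or_im_I_eq_one (K := 𝕜) with h | h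
  · simpa [h] using Complex.abs_re_le_norm z
  · refine le_of_eq ?_
    rw [← sq_eq_sq₀ (norm_nonneg _) (norm_nonneg _), ← RCLike.normSq_eq_def', RCLike.normSq_apply,
      Complex.sq_norm, Complex.normSq_apply]
    simp [h]

/-- At real points the powers of `x` are real scalars, so the real-linear map (the real part when
`𝕜` is real) can be applied coefficientwise. -/
theorem exists_polynomial_map_eval (p : ℂ[X]) {k : ℕ} (hp : p.degree < k) :
    ∃ q : 𝕜[X], q.degree < k ∧ ∀ x : ℝ, q.eval (x : 𝕜) = RCLike.map ℂ 𝕜 (p.eval (x : ℂ)) := by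
  refine ⟨∑ j ∈ p.support, monomial j (RCLike.map ℂ 𝕜 (p.coeff j)), ?_, fun x => ?_⟩
  · rw [← mem_degreeLT]
    refine Submodule.sum_mem _ fun j hj => mem_degreeLT.2 ?_
    exact (degree_monomial_le _ _).trans_lt ((le_degree_of_mem_supp j hj).trans_lt hp)
  · rw [eval_eq_sum (p := p), Polynomial.sum, map_sum, eval_finsetSum]
    refine Finset.sum_congr rfl fun j _ => ?_
    rw [eval_monomial, ← Complex.ofReal_pow, mul_comm (p.coeff j), ← Complex.real_smul, map_smul,
      RCLike.real_smul_eq_coe_mul, mul_comm]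
    push_cast
    rfl

end Transfer

/-! ### The `L²` distance and the conclusion -/

theorem polyDist_le {𝕜 : Type*} [RCLike 𝕜] {n : ℕ} {v : ℝ → 𝕜} {q : 𝕜[X]} {ε : ℝ}
    (hq : q.degree ≤ n) (h : ∀ᵐ x ∂intervalMeasure, ‖v x - q.eval (x : 𝕜)‖ ≤ ε) (hε : 0 ≤ ε) :
    polyDist v n ≤ 2 * ε := by
  refine (ciInf_le ⟨0, ?_⟩ (⟨q, mem_degreeLE.2 hq⟩ : degreeLE 𝕜 (n : WithBot ℕ))).trans ?_
  · rintro _ ⟨p, rfl⟩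
    exact ENNReal.toReal_nonneg
  · refine (ENNReal.toReal_mono ?_ (eLpNorm_le_of_ae_bound h)).trans ?_
    · exact ENNReal.mul_ne_top (by rw [intervalMeasure_univ]; simp) ENNReal.ofReal_ne_top
    · rw [intervalMeasure_univ, ENNReal.toReal_mul, ENNReal.toReal_ofReal hε,
        ← ENNReal.toReal_rpow]
      gcongr
      -- The interval has mass `2`; the factor `√2` is rounded up to `2`.
      calc _ ≤ (2 : ℝ) ^ (1 : ℝ) := by
            simpa using Real.rpow_le_rpow_of_exponent_le (x := 2) (by norm_num)
              (show (2 : ℝ)⁻¹ ≤ 1 by norm_num)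
        _ = 2 := by simp

end BernsteinLegendre

theorem mainTheorem8 :
    ∃ C C' : ℝ → ℝ, ∀ r : ℝ, 1 < r →
      ∀ (𝕜 : Type*) [RCLike 𝕜] (v : ℝ → 𝕜) (F : ℂ → ℂ),
        MemLp v 2 BernsteinLegendre.intervalMeasure →
        AnalyticOnNhd ℂ F (BernsteinLegendre.ellipse r) →
        (∀ᵐ x ∂BernsteinLegendre.intervalMeasure, RCLike.map 𝕜 ℂ (v x) = F (x : ℂ)) →
        (∀ k : ℕ, ‖BernsteinLegendre.legendreCoeff v k‖ ≤
          C r * sSup ((fun z => ‖F z‖) '' BernsteinLegendre.ellipse r) *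
            Real.sqrt (2 * (2 * (k : ℝ) + 1)) * Real.exp (-(Real.log r * k))) ∧
        (∀ n : ℕ, BernsteinLegendre.polyDist v n ≤
          C' r * sSup ((fun z => ‖F z‖) '' BernsteinLegendre.ellipse r) *
            ((n : ℝ) + 1) ^ (1 / 2 : ℝ) * Real.exp (-(Real.log r * n))) := by
  refine ⟨fun r => 2 * r / (r - 1), fun r => 4 / (r - 1), fun r hr 𝕜 _ v F hv hF hvF => ?_⟩
  have hr0 : 0 < r := by linarith
  have hr1 : 0 < r - 1 := by linarith
  set M := sSup ((fun z => ‖F z‖) '' BernsteinLegendre.ellipse r)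
  have hbdd : BddAbove ((fun z => ‖F z‖) '' BernsteinLegendre.ellipse r) :=
    (BernsteinLegendre.isCompact_ellipse r).bddAbove_image hF.continuousOn.norm
  have hM (z : ℂ) (hz : z ∈ BernsteinLegendre.ellipse r) : ‖F z‖ ≤ M :=
    le_csSup hbdd ⟨z, hz, rfl⟩
  have hM0 : 0 ≤ M := Real.sSup_nonneg (by rintro _ ⟨z, -, rfl⟩; exact norm_nonneg _)
  have hexp (n : ℕ) : Real.exp (-(Real.log r * n)) = r⁻¹ ^ n := by
    rw [mul_comm, Real.exp_neg, Real.exp_nat_mul, Real.exp_log hr0, inv_pow]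
  have happrox (k : ℕ) : ∃ q : 𝕜[X], q.degree < k ∧
      ∀ᵐ x ∂BernsteinLegendre.intervalMeasure,
        ‖v x - q.eval (x : 𝕜)‖ ≤ 2 * r / (r - 1) * M * r⁻¹ ^ k := by
    obtain ⟨p, hp, hpF⟩ := BernsteinLegendre.exists_polynomial_approx hr hF hM k
    obtain ⟨q, hq, hqp⟩ := BernsteinLegendre.exists_polynomial_map_eval (𝕜 := 𝕜) p hp
    refine ⟨q, hq, ?_⟩
    filter_upwards [hvF, ae_restrict_mem measurableSet_Ioo] with x hx hxI
    rw [hqp, ← BernsteinLegendre.map_map_complex (v x), hx, ← map_sub]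
    exact (BernsteinLegendre.norm_map_complex_le _).trans (hpF x hxI.1.le hxI.2.le)
  refine ⟨fun k => ?_, fun n => ?_⟩
  · obtain ⟨q, hq, h⟩ := happrox k
    have := BernsteinLegendre.norm_legendreCoeff_le (hv.integrable one_le_two) hq h
      (by positivity)
    rw [hexp]
    linarith
  -- Degree at most `n` means below `n + 1`; the extra `r⁻¹` cancels the `r` in `2r/(r-1)`, giving
  -- `4/(r-1)`. The factor `(n+1)^(1/2)` is pure slack.
  · obtain ⟨q, hq, h⟩ := happrox (n + 1)
    have hqn : q.degree ≤ n := by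
      rw [← mem_degreeLE, ← degreeLT_succ_eq_degreeLE]
      exact mem_degreeLT.2 hq
    rw [hexp]
    have h1 : 1 ≤ ((n : ℝ) + 1) ^ (1 / 2 : ℝ) :=
      Real.one_le_rpow (by linarith [n.cast_nonneg (α := ℝ)]) (by norm_num)
    calc _ ≤ 2 * (2 * r / (r - 1) * M * r⁻¹ ^ (n + 1)) :=
          BernsteinLegendre.polyDist_le hqn h (by positivity)
      _ = 4 / (r - 1) * M * 1 * r⁻¹ ^ n := by
          rw [pow_succ]
          field_simp
          ring
      _ ≤ _ := by gcongr
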